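/- \textbf{Theorem (Weierstrass' theorem).} Let $Cl(0,n)$ be the real Clifford algebra with generators $e_1,\dots,e_n$, $e_ie_j+e_je_i=-2\delta_{ij}$, and let $V$ be a finite-dimensional real normed space on which $Cl(0,n)$ acts linearly (for instance $V=Cl(0,n)$ with left multiplication). Let $\Omega\subset\mathbb{R}^{n+1}$ be open, with coordinates $y=(y_0,\dots,y_n)$, and let $$Df=\frac{\partial f}{\partial y_0}-\sum_{j=1}^n e_j\frac{\partial f}{\partial y_j}$$ be the generalized Cauchy--Riemann operator. Let $M$ be a linear operator on the space $C(\Omega,V)$ of continuous functions that is continuous for uniform convergence on compact subsets of $\Omega$ and commutes with $D$: for every $u\in C(\Omega,V)$ of class $C^1$, $Mu$ is of class $C^1$ and $D(Mu)=M(Du)$. Denote by $\mathcal{M}_M(\Omega)$ the set of all $f:\Omega\to V$ of class $C^1$ with $$\frac{\partial f}{\partial y_0}=\sum_{j=1}^n e_j\frac{\partial f}{\partial y_j}+Mf\quad\text{in }\Omega.$$ Let $(f_k)_{k\in\mathbb{N}}$ be a sequence in $\mathcal{M}_M(\Omega)$ which converges to a function $f:\Omega\to V$ uniformly on each compact subset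 of $\Omega$. Then \begin{enumerate} \item $f\in\mathcal{M}_M(\Omega)$; \item all $f_k$ and $f$ are of class $C^\infty$ on $\Omega$, and for each multi-index $\beta=(\beta_0,\dots,\beta_n)\in\mathbb{N}^{n+1}$ the sequence $(\partial^\beta f_k)_{k\in\mathbb{N}}$ converges to $\partial^\beta f$ uniformly on each compact subset of $\Omega$. \end{enumerate} -/

import Mathlib

open Filter Topology TopologicalSpace
open scoped ContDiff

namespace CliffordWeierstrass

noncomputable section

/-- The quadratic form `v ↦ -∑ j, v j ^ 2` on `ℝ ^ n`. -/
def negForm (n : ℕ) : QuadraticForm ℝ (Fin n → ℝ) :=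
  QuadraticMap.weightedSumSquares ℝ (fun _ : Fin n => (-1 : ℝ))

/-- The real Clifford algebra `Cl(0,n)`, in which `e i * e j + e j * e i = -2 δ i j`. -/
abbrev Cl (n : ℕ) : Type := CliffordAlgebra (negForm n)

/-- The generators `e 1, …, e n` of `Cl(0,n)` (indexed from `0`). -/
def gen {n : ℕ} (j : Fin n) : Cl n :=
  CliffordAlgebra.ι (negForm n) (Pi.single j 1)

/-- The space `ℝ ^ (n + 1)` of points `y = (y 0, y 1, …, y n)`. -/
abbrev Space (n : ℕ) : Type := EuclideanSpace ℝ (Fin (n + 1))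

section Calculus

variable {n : ℕ} {Ω : Opens (Space n)}
variable {V : Type*} [NormedAddCommGroup V] [NormedSpace ℝ V]

/-- The extension by zero of a function on `Ω` to the whole space. It only serves to let Mathlib's
derivatives act on `f`: since `Ω` is open, they do not depend on the extension at points of `Ω`. -/
def zeroExt (f : Ω → V) : Space n → V :=
  Function.extend Subtype.val f 0

/-- `f : Ω → V` is of class `C^r` on the open set `Ω`. -/
def IsOfClass (r : ℕ∞) (f : Ω → V) : Prop :=
  ContDiffOn ℝ (r : WithTop ℕ∞) (zeroExt f) (Ω : Set (Space n))

/-- The partial derivative `∂f/∂y_j` of `f : Ω → V`. -/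
def pderiv (j : Fin (n + 1)) (f : Ω → V) : Ω → V :=
  fun x => fderiv ℝ (zeroExt f) (x : Space n) (EuclideanSpace.single j 1)

/-- The higher partial derivative `∂^β f = ∂_0^{β_0} ∂_1^{β_1} ⋯ ∂_n^{β_n} f`. -/
def multiDeriv (β : Fin (n + 1) → ℕ) (f : Ω → V) : Ω → V :=
  (List.finRange (n + 1)).foldr (fun j g => (pderiv j)^[β j] g) f

variable [Module (Cl n) V]

/-- The generalized Cauchy-Riemann operator `D f = ∂f/∂y_0 - ∑_{j=1}^n e_j ∂f/∂y_j`. -/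
def cauchyRiemann (f : Ω → V) : Ω → V :=
  fun x => pderiv 0 f x - ∑ j : Fin n, gen j • pderiv j.succ f x

/-- The operator `M` commutes with the generalized Cauchy-Riemann operator `D`: if `u` is of class
`C^1` and `D u = v`, then `M u` is of class `C^1` and `D (M u) = M v`. -/
def CommutesWithCauchyRiemann (M : C(Ω, V) →L[ℝ] C(Ω, V)) : Prop :=
  ∀ u v : C(Ω, V), IsOfClass 1 (u : Ω → V) → cauchyRiemann (u : Ω → V) = v →
    IsOfClass 1 (M u : Ω → V) ∧ cauchyRiemann (M u : Ω → V) = M v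

/-- The set of `M`-solutions on `Ω`: the functions `f` of class `C^1` on `Ω` with
`∂f/∂y_0 = ∑_{j=1}^n e_j ∂f/∂y_j + M f`. Here `u` is `f` as an element of `C(Ω, V)`. -/
def MSolutions (M : C(Ω, V) →L[ℝ] C(Ω, V)) : Set (Ω → V) :=
  {f | ∃ u : C(Ω, V), (u : Ω → V) = f ∧ IsOfClass 1 f ∧
    ∀ x : Ω, pderiv 0 f x = (∑ j : Fin n, gen j • pderiv j.succ f x) + M u x}

end Calculus

end

end CliffordWeierstrass

/-! A solution satisfies `D f = M f`, and commutation gives `D (M^k f) = M^(k+1) f` for every `k`.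
So each solution starts an infinite chain of `C^1` functions in which `D` maps each member to the
next. Continuity of `M` makes every member `M^k f_j` converge to `M^k f` locally uniformly. The
operator `M` plays no further role: what remains is interior elliptic regularity for such chains.

Ellipticity comes from the conjugate operator: the Clifford relations say that its product with `D`
is the Laplacian. Integration by parts then bounds the `L²` norm of every first derivative of a
smooth compactly supported function by that of its image under `D` (`exists_energy_bound`). With
cutoffs, each derivative is traded for one application of `D`, that is, for one step along the chain
(`controlled_integral_smul_pdList`). A crude Sobolev inequality (`norm_le_integral_pdList`) turns
the `L²` bounds into sup bounds, so any derivative of the first member is bounded on a compact set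
by finitely many members on a larger one (`exists_norm_pdList_le`).

Applied to differences of chains, this estimate makes all derivatives uniformly Cauchy. Applied to
mollified chains, it shows that the `C^1` chains were smooth from the start
(`contDiffOn_infty_of_diracOp`). -/

namespace CliffordWeierstrass

set_option linter.unusedSectionVars false

/-! ### Calculus of iterated partial derivatives and of constant-coefficient first-order operators.
-/

section PartialDerivatives

variable {ι : Type*} [Fintype ι] [DecidableEq ι]
variable {V : Type*} [NormedAddCommGroup V] [NormedSpace ℝ V]

/-- The partial derivative of `f` in the direction of the `i`-th coordinate. -/
noncomputable def pd (i : ι) (f : EuclideanSpace ℝ ι → V) : EuclideanSpace ℝ ι → V :=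
  fun x => fderiv ℝ f x (EuclideanSpace.single i 1)

/-- Iterated partial derivatives along a list of coordinates. -/
noncomputable def pdList (l : List ι) (f : EuclideanSpace ℝ ι → V) : EuclideanSpace ℝ ι → V :=
  l.foldr pd f

@[simp] lemma pdList_nil (f : EuclideanSpace ℝ ι → V) : pdList [] f = f := rfl

@[simp] lemma pdList_cons (i : ι) (l : List ι) (f : EuclideanSpace ℝ ι → V) :
    pdList (i :: l) f = pd i (pdList l f) := rfl

lemma pdList_append (l m : List ι) (f : EuclideanSpace ℝ ι → V) :
    pdList (l ++ m) f = pdList l (pdList m f) := by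
  simp [pdList]

lemma contDiff_pd {f : EuclideanSpace ℝ ι → V} (hf : ContDiff ℝ ∞ f) (i : ι) :
    ContDiff ℝ ∞ (pd i f) :=
  (hf.fderiv_right (m := ∞) le_rfl).clm_apply contDiff_const

lemma contDiff_pdList {f : EuclideanSpace ℝ ι → V} (hf : ContDiff ℝ ∞ f) (l : List ι) :
    ContDiff ℝ ∞ (pdList l f) := by
  induction l with
  | nil => exact hf
  | cons i l ih => exact contDiff_pd ih i

lemma tsupport_pd_subset (i : ι) (f : EuclideanSpace ℝ ι → V) :
    tsupport (pd i f) ⊆ tsupport f :=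
  tsupport_fderiv_apply_subset ℝ _

lemma hasCompactSupport_pd {f : EuclideanSpace ℝ ι → V} (hf : HasCompactSupport f) (i : ι) :
    HasCompactSupport (pd i f) :=
  hf.fderiv_apply ℝ _

lemma hasCompactSupport_pdList {f : EuclideanSpace ℝ ι → V} (hf : HasCompactSupport f)
    (l : List ι) : HasCompactSupport (pdList l f) := by
  induction l with
  | nil => exact hf
  | cons i l ih => exact hasCompactSupport_pd ih i

lemma tsupport_pdList_subset (l : List ι) (f : EuclideanSpace ℝ ι → V) :
    tsupport (pdList l f) ⊆ tsupport f := by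
  induction l with
  | nil => exact subset_rfl
  | cons i l ih => exact (tsupport_pd_subset i _).trans ih

lemma pd_eqOn {f g : EuclideanSpace ℝ ι → V} {U : Set (EuclideanSpace ℝ ι)} (hU : IsOpen U)
    (h : Set.EqOn f g U) (i : ι) : Set.EqOn (pd i f) (pd i g) U := fun x hx => by
  have : f =ᶠ[𝓝 x] g := Filter.eventuallyEq_of_mem (hU.mem_nhds hx) h
  simp only [pd, this.fderiv_eq]

lemma pdList_eqOn {f g : EuclideanSpace ℝ ι → V} {U : Set (EuclideanSpace ℝ ι)} (hU : IsOpen U)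
    (h : Set.EqOn f g U) (l : List ι) : Set.EqOn (pdList l f) (pdList l g) U := by
  induction l with
  | nil => exact h
  | cons i l ih => exact pd_eqOn hU ih i

lemma pd_smul {χ : EuclideanSpace ℝ ι → ℝ} {f : EuclideanSpace ℝ ι → V} (i : ι)
    {x : EuclideanSpace ℝ ι} (hχ : DifferentiableAt ℝ χ x) (hf : DifferentiableAt ℝ f x) :
    pd i (fun y => χ y • f y) x = χ x • pd i f x + pd i χ x • f x := by
  simp only [pd]
  rw [fderiv_fun_smul hχ hf]
  simp

lemma pd_add {f g : EuclideanSpace ℝ ι → V} (i : ι)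
    {x : EuclideanSpace ℝ ι} (hf : DifferentiableAt ℝ f x) (hg : DifferentiableAt ℝ g x) :
    pd i (fun y => f y + g y) x = pd i f x + pd i g x := by
  simp only [pd]
  rw [fderiv_fun_add hf hg]
  simp

lemma pdList_add {f g : EuclideanSpace ℝ ι → V} (hf : ContDiff ℝ ∞ f) (hg : ContDiff ℝ ∞ g)
    (l : List ι) : pdList l (fun y => f y + g y) = fun y => pdList l f y + pdList l g y := by
  induction l with
  | nil => rfl
  | cons i l ih =>
    ext x
    rw [pdList_cons, ih]
    exact pd_add i ((contDiff_pdList hf l).differentiable (by simp) x)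
      ((contDiff_pdList hg l).differentiable (by simp) x)

lemma pd_sub {f g : EuclideanSpace ℝ ι → V} (i : ι)
    {x : EuclideanSpace ℝ ι} (hf : DifferentiableAt ℝ f x) (hg : DifferentiableAt ℝ g x) :
    pd i (fun y => f y - g y) x = pd i f x - pd i g x := by
  simp only [pd]
  rw [fderiv_fun_sub hf hg]
  simp

lemma pdList_sub {f g : EuclideanSpace ℝ ι → V} (hf : ContDiff ℝ ∞ f) (hg : ContDiff ℝ ∞ g)
    (l : List ι) : pdList l (fun y => f y - g y) = fun y => pdList l f y - pdList l g y := by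
  induction l with
  | nil => rfl
  | cons i l ih =>
    ext x
    rw [pdList_cons, ih]
    exact pd_sub i ((contDiff_pdList hf l).differentiable (by simp) x)
      ((contDiff_pdList hg l).differentiable (by simp) x)

lemma pd_clm {W : Type*} [NormedAddCommGroup W] [NormedSpace ℝ W]
    {f : EuclideanSpace ℝ ι → V} (L : V →L[ℝ] W) (i : ι)
    {x : EuclideanSpace ℝ ι} (hf : DifferentiableAt ℝ f x) :
    pd i (fun y => L (f y)) x = L (pd i f x) := by
  simp only [pd]
  have := (L.hasFDerivAt.comp x hf.hasFDerivAt).fderiv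
  have h2 : (fun y => L (f y)) = L ∘ f := rfl
  rw [h2, this]
  simp

lemma pd_sum {κ : Type*} (s : Finset κ) {f : κ → EuclideanSpace ℝ ι → V} (i : ι)
    {x : EuclideanSpace ℝ ι} (hf : ∀ k ∈ s, DifferentiableAt ℝ (f k) x) :
    pd i (fun y => ∑ k ∈ s, f k y) x = ∑ k ∈ s, pd i (f k) x := by
  simp only [pd]
  rw [fderiv_fun_sum hf]
  simp

lemma pd_comm {f : EuclideanSpace ℝ ι → V} (hf : ContDiff ℝ ∞ f) (i j : ι) :
    pd i (pd j f) = pd j (pd i f) := by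
  ext x
  have hd : DifferentiableAt ℝ (fderiv ℝ f) x :=
    (hf.fderiv_right (m := ∞) le_rfl).differentiable (by simp) x
  have key : ∀ i j : ι, pd i (pd j f) x =
      fderiv ℝ (fderiv ℝ f) x (EuclideanSpace.single i 1) (EuclideanSpace.single j 1) := by
    intro i j
    unfold pd
    rw [fderiv_clm_apply hd (differentiableAt_const _)]
    simp
  rw [key, key]
  exact (hf.contDiffAt.isSymmSndFDerivAt (by simpa using WithTop.coe_le_coe.2 (le_top : (2 : ℕ∞) ≤ ⊤))) _ _

/-- The first-order operator `∑ i, a i ∂_i`. -/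
noncomputable def diracOp (a : ι → V →L[ℝ] V) (f : EuclideanSpace ℝ ι → V) :
    EuclideanSpace ℝ ι → V :=
  fun x => ∑ i, a i (pd i f x)

lemma contDiff_diracOp (a : ι → V →L[ℝ] V) {f : EuclideanSpace ℝ ι → V} (hf : ContDiff ℝ ∞ f) :
    ContDiff ℝ ∞ (diracOp a f) :=
  ContDiff.sum fun i _ => (a i).contDiff.comp (contDiff_pd hf i)

lemma pd_diracOp (a : ι → V →L[ℝ] V) {f : EuclideanSpace ℝ ι → V} (hf : ContDiff ℝ ∞ f) (i : ι) :
    pd i (diracOp a f) = diracOp a (pd i f) := by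
  ext x
  unfold diracOp
  rw [pd_sum]
  · refine Finset.sum_congr rfl fun k _ => ?_
    rw [pd_clm (a k) i ((contDiff_pd hf k).differentiable (by simp) x), pd_comm hf]
  · intro k _
    exact ((a k).contDiff.comp (contDiff_pd hf k)).differentiable (n := ∞) (by simp) x

lemma pdList_diracOp (a : ι → V →L[ℝ] V) {f : EuclideanSpace ℝ ι → V} (hf : ContDiff ℝ ∞ f)
    (l : List ι) : pdList l (diracOp a f) = diracOp a (pdList l f) := by
  induction l with
  | nil => rfl
  | cons i l ih => rw [pdList_cons, ih, pd_diracOp a (contDiff_pdList hf l), pdList_cons]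

lemma diracOp_smul (a : ι → V →L[ℝ] V) {χ : EuclideanSpace ℝ ι → ℝ} {f : EuclideanSpace ℝ ι → V}
    {x : EuclideanSpace ℝ ι} (hχ : DifferentiableAt ℝ χ x) (hf : DifferentiableAt ℝ f x) :
    diracOp a (fun y => χ y • f y) x =
      χ x • diracOp a f x + ∑ i, pd i χ x • a i (f x) := by
  simp only [diracOp, pd_smul _ hχ hf, map_add, map_smul, Finset.sum_add_distrib,
    Finset.smul_sum]

end PartialDerivatives

/-! ### A Sobolev-type inequality and the `L²` energy estimate. -/

section Integrals

open MeasureTheory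

variable {ι : Type*} [Fintype ι] [DecidableEq ι]
variable {V : Type*} [NormedAddCommGroup V] [NormedSpace ℝ V]

/-- Fundamental theorem of calculus on the line through `x` parallel to the `i`-th axis; compact
support removes the boundary term. -/
lemma enorm_le_lintegral_pd {v : EuclideanSpace ℝ ι → V} (hv : ContDiff ℝ ∞ v)
    (hc : HasCompactSupport v) (i : ι) (x : ι → ℝ) :
    ‖v (WithLp.toLp 2 x)‖ₑ ≤ ∫⁻ t, ‖pd i v (WithLp.toLp 2 (Function.update x i t))‖ₑ := by
  let T : (ι → ℝ) ≃L[ℝ] EuclideanSpace ℝ ι := (EuclideanSpace.equiv ι ℝ).symm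
  have hvT : ContDiff ℝ 1 (v ∘ T) := (hv.of_le (by simp)).comp T.contDiff
  have hcT : HasCompactSupport (v ∘ T) := hc.comp_homeomorph T.toHomeomorph
  have h1 : ContDiff ℝ 1 ((v ∘ T) ∘ Function.update x i) :=
    hvT.comp (by convert! contDiff_update 1 x i)
  have h2 : HasCompactSupport ((v ∘ T) ∘ Function.update x i) :=
    hcT.comp_isClosedEmbedding (isClosedEmbedding_update x i)
  have h3 := HasCompactSupport.enorm_le_lintegral_Ici_deriv h1 h2 (x i)
  have h4 : ((v ∘ T) ∘ Function.update x i) (x i) = v (WithLp.toLp 2 x) := by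
    simp only [Function.comp_apply, Function.update_eq_self]; rfl
  rw [h4] at h3
  refine h3.trans ((setLIntegral_le_lintegral _ _).trans_eq (lintegral_congr fun t => ?_))
  congr 1
  have hd : HasDerivAt (fun t => T (Function.update x i t)) (EuclideanSpace.single i 1) t := by
    have := T.hasFDerivAt.comp_hasDerivAt t (hasDerivAt_update x i t)
    exact this
  have := ((hv.differentiable (by simp) (T (Function.update x i t))).hasFDerivAt).comp_hasDerivAt
    t hd
  exact this.deriv

lemma enorm_le_lmarginal_pdList {v : EuclideanSpace ℝ ι → V} (hv : ContDiff ℝ ∞ v)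
    (hc : HasCompactSupport v) (l : List ι) (hl : l.Nodup) (x : ι → ℝ) :
    ‖v (WithLp.toLp 2 x)‖ₑ ≤
      (∫⋯∫⁻_l.toFinset, (fun y => ‖pdList l v (WithLp.toLp 2 y)‖ₑ) ∂(fun _ => volume)) x := by
  induction l generalizing x with
  | nil => simp
  | cons i l ih =>
    have hi : i ∉ l.toFinset := by simpa using (List.nodup_cons.1 hl).1
    refine (ih (List.nodup_cons.1 hl).2 x).trans ?_
    rw [List.toFinset_cons, lmarginal_insert' _ _ hi]
    · refine lmarginal_mono (fun y => ?_) x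
      exact enorm_le_lintegral_pd (contDiff_pdList hv l) (hasCompactSupport_pdList hc l) i y
    · have : Continuous fun y : ι → ℝ => pdList (i :: l) v (WithLp.toLp 2 y) :=
        (contDiff_pdList hv _).continuous.comp (PiLp.continuous_toLp 2 _)
      exact this.enorm.measurable

/-- A crude Sobolev embedding: integrating along each axis once costs one derivative per coordinate
and yields a sup bound by an `L¹` norm. -/
lemma norm_le_integral_pdList {v : EuclideanSpace ℝ ι → V} (hv : ContDiff ℝ ∞ v)
    (hc : HasCompactSupport v) (x : EuclideanSpace ℝ ι) :
    ‖v x‖ ≤ ∫ y, ‖pdList (Finset.univ : Finset ι).toList v y‖ := by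
  set l := (Finset.univ : Finset ι).toList
  have hcont := (contDiff_pdList hv l).continuous
  have hint : Integrable (pdList l v) :=
    hcont.integrable_of_hasCompactSupport (hasCompactSupport_pdList hc l)
  have h := enorm_le_lmarginal_pdList hv hc l (Finset.nodup_toList _) (WithLp.ofLp x)
  rw [Finset.toList_toFinset, lmarginal_univ, ← volume_pi,
    (PiLp.volume_preserving_toLp ι).lintegral_comp (f := fun y => ‖pdList l v y‖ₑ)
      hcont.enorm.measurable] at h
  rw [integral_norm_eq_lintegral_enorm hint.1, ← toReal_enorm]
  exact ENNReal.toReal_mono hint.2.ne h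

lemma integrable_norm_sq {v : EuclideanSpace ℝ ι → V} (hv : Continuous v)
    (hc : HasCompactSupport v) : Integrable (fun x => ‖v x‖ ^ 2) := by
  refine (hv.norm.pow 2).integrable_of_hasCompactSupport (hc.mono ?_)
  intro x hx hx'
  exact hx (by simp [hx'])

lemma hasCompactSupport_diracOp (a : ι → V →L[ℝ] V) {v : EuclideanSpace ℝ ι → V}
    (hc : HasCompactSupport v) : HasCompactSupport (diracOp a v) := by
  refine hc.mono' fun x hx => ?_
  by_contra h
  refine hx (Finset.sum_eq_zero fun i _ => ?_)
  have : pd i v x = 0 := by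
    by_contra h'
    exact h (tsupport_pd_subset i v (subset_tsupport _ h'))
  simp [this]

section Inner

variable {W : Type*} [NormedAddCommGroup W] [InnerProductSpace ℝ W]

lemma integral_inner_pd {f g : EuclideanSpace ℝ ι → W} (hf : ContDiff ℝ 1 f) (hg : ContDiff ℝ 1 g)
    (hfc : HasCompactSupport f) (i : ι) :
    ∫ x, inner ℝ (f x) (pd i g x) = - ∫ x, inner ℝ (pd i f x) (g x) := by
  have hf' : Continuous (pd i f) :=
    (hf.continuous_fderiv one_ne_zero).clm_apply continuous_const
  have hg' : Continuous (pd i g) :=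
    (hg.continuous_fderiv one_ne_zero).clm_apply continuous_const
  have key : ∀ {p q : EuclideanSpace ℝ ι → W}, Continuous p → Continuous q →
      HasCompactSupport p → Integrable (fun x => innerSL ℝ (p x) (q x)) := by
    intro p q hp hq hpc
    refine (hp.inner hq).integrable_of_hasCompactSupport (hpc.mono ?_)
    intro x hx hpx
    exact hx (by simp [hpx])
  exact integral_bilinear_fderiv_right_eq_neg_left_of_integrable (B := innerSL ℝ)
    (key hf' hg.continuous (hasCompactSupport_pd hfc i)) (key hf.continuous hg' hfc)
    (key hf.continuous hg.continuous hfc)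
    (fun x _ => hf.differentiable one_ne_zero x) (fun x _ => hg.differentiable one_ne_zero x)

/-- Both sides equal `-∫ ⟨v, T ∂_i ∂_k v⟩` after one integration by parts, because `T` is constant
and partial derivatives commute. -/
lemma integral_inner_pd_swap {v : EuclideanSpace ℝ ι → W} (hv : ContDiff ℝ ∞ v)
    (hc : HasCompactSupport v) (T : W →L[ℝ] W) (i k : ι) :
    ∫ x, inner ℝ (pd i v x) (T (pd k v x)) = ∫ x, inner ℝ (pd k v x) (T (pd i v x)) := by
  have key : ∀ i k, ∫ x, inner ℝ (pd i v x) (T (pd k v x)) =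
      - ∫ x, inner ℝ (v x) (T (pd i (pd k v) x)) := by
    intro i k
    have h := integral_inner_pd (f := v) (g := fun x => T (pd k v x)) (hv.of_le (by simp))
      (T.contDiff.comp ((contDiff_pd hv k).of_le (by simp))) hc i
    rw [← neg_eq_iff_eq_neg.2 h]
    congr 2
    ext x
    rw [pd_clm T i ((contDiff_pd hv k).differentiable (by simp) x)]
  rw [key, key, pd_comm hv]

/-- The hypothesis `hab` says that `∑ b_i ∂_i` composed with `∑ a_k ∂_k` is the Laplacian. Hence the
Dirichlet energy equals `∑ ∫ ⟨∂_i v, b_i D v⟩`, and Young's inequality concludes. No adjointness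
relation between the `a_i` and `b_i` is needed. -/
lemma energy_inner {a b : ι → W →L[ℝ] W}
    (hab : ∀ i k w, b i (a k w) + b k (a i w) = if i = k then (2 : ℝ) • w else 0)
    {v : EuclideanSpace ℝ ι → W} (hv : ContDiff ℝ ∞ v) (hc : HasCompactSupport v) :
    ∑ i, ∫ x, ‖pd i v x‖ ^ 2 ≤ (∑ i, ‖b i‖ ^ 2) * ∫ x, ‖diracOp a v x‖ ^ 2 := by
  have hcd := fun i => (contDiff_pd hv i).continuous
  have hint : ∀ (i k : ι) (T : W →L[ℝ] W),
      Integrable (fun x => inner ℝ (pd i v x) (T (pd k v x))) := by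
    intro i k T
    refine ((hcd i).inner (T.continuous.comp (hcd k))).integrable_of_hasCompactSupport
      ((hasCompactSupport_pd hc i).mono ?_)
    intro x hx hpx
    exact hx (by simp [hpx])
  have hsq : ∀ i, Integrable (fun x => ‖pd i v x‖ ^ 2) := fun i =>
    integrable_norm_sq (hcd i) (hasCompactSupport_pd hc i)
  have hDsq : Integrable (fun x => ‖diracOp a v x‖ ^ 2) :=
    integrable_norm_sq (contDiff_diracOp a hv).continuous (hasCompactSupport_diracOp a hc)
  have hS : ∀ i, ∫ x, inner ℝ (pd i v x) (b i (diracOp a v x)) =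
      ∑ k, ∫ x, inner ℝ (pd i v x) ((b i ∘L a k) (pd k v x)) := by
    intro i
    rw [← integral_finsetSum _ fun k _ => hint i k _]
    congr 1
    ext x
    simp [diracOp, map_sum, inner_sum]
  have hswap : ∑ i, ∑ k, ∫ x, inner ℝ (pd i v x) ((b i ∘L a k) (pd k v x)) =
      ∑ i, ∑ k, ∫ x, inner ℝ (pd i v x) ((b k ∘L a i) (pd k v x)) := by
    rw [Finset.sum_comm]
    exact Finset.sum_congr rfl fun k _ => Finset.sum_congr rfl fun i _ =>
      integral_inner_pd_swap hv hc _ i k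
  have hsum : ∑ i, ∫ x, ‖pd i v x‖ ^ 2 =
      ∑ i, ∫ x, inner ℝ (pd i v x) (b i (diracOp a v x)) := by
    simp_rw [hS]
    -- Symmetrizing in `i` and `k` brings in `b_i a_k + b_k a_i`, so the off-diagonal terms cancel
    -- and the diagonal gives twice the energy.
    have h2 : 2 * ∑ i, ∫ x, ‖pd i v x‖ ^ 2 =
        (∑ i, ∑ k, ∫ x, inner ℝ (pd i v x) ((b i ∘L a k) (pd k v x))) +
        ∑ i, ∑ k, ∫ x, inner ℝ (pd i v x) ((b k ∘L a i) (pd k v x)) := by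
      rw [← Finset.sum_add_distrib, Finset.mul_sum]
      refine Finset.sum_congr rfl fun i _ => ?_
      rw [← Finset.sum_add_distrib, Finset.sum_eq_single i]
      · rw [← integral_add (hint _ _ _) (hint _ _ _), ← integral_const_mul]
        congr 1
        ext x
        have := hab i i (pd i v x)
        simp only [if_true] at this
        rw [← inner_add_right, ContinuousLinearMap.comp_apply, this, inner_smul_right,
          real_inner_self_eq_norm_sq]
      · intro k _ hk
        rw [← integral_add (hint _ _ _) (hint _ _ _)]
        refine integral_eq_zero_of_ae (ae_of_all _ fun x => ?_)
        have := hab i k (pd k v x)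
        rw [if_neg (Ne.symm hk)] at this
        simp only [ContinuousLinearMap.comp_apply, Pi.zero_apply]
        rw [← inner_add_right, this, inner_zero_right]
      · simp
    linarith
  -- The weight `1 / 2` leaves half of the energy on the right, to be absorbed on the left.
  have hle : ∀ i, ∫ x, inner ℝ (pd i v x) (b i (diracOp a v x)) ≤
      (1 / 2) * (∫ x, ‖pd i v x‖ ^ 2) + (1 / 2) * (‖b i‖ ^ 2 * ∫ x, ‖diracOp a v x‖ ^ 2) := by
    intro i
    have hr : Integrable (fun x => (1 / 2 : ℝ) * ‖pd i v x‖ ^ 2 +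
        (1 / 2) * (‖b i‖ ^ 2 * ‖diracOp a v x‖ ^ 2)) :=
      ((hsq i).const_mul _).add ((hDsq.const_mul _).const_mul _)
    have hl : Integrable (fun x => inner ℝ (pd i v x) (b i (diracOp a v x))) := by
      refine (integrable_finsetSum Finset.univ
        fun k _ => hint i k (b i ∘L a k)).congr (ae_of_all _ fun x => ?_)
      simp [diracOp, map_sum, inner_sum]
    have := integral_mono hl hr (fun x => by
      have h1 := real_inner_le_norm (pd i v x) (b i (diracOp a v x))
      have h2 := (b i).le_opNorm (diracOp a v x)
      have h3 := mul_le_mul_of_nonneg_left h2 (norm_nonneg (pd i v x))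
      have h4 := sq_nonneg (‖pd i v x‖ - ‖b i‖ * ‖diracOp a v x‖)
      simp only
      nlinarith)
    rwa [integral_add ((hsq i).const_mul _) ((hDsq.const_mul _).const_mul _),
      integral_const_mul, integral_const_mul, integral_const_mul] at this
  have hfin := Finset.sum_le_sum fun i (_ : i ∈ Finset.univ) => hle i
  rw [← hsum, Finset.sum_add_distrib, ← Finset.mul_sum, ← Finset.mul_sum, ← Finset.sum_mul] at hfin
  linarith

end Inner

/-- The norm of `V` need not come from an inner product. Conjugating by a linear isomorphism with a
Euclidean space preserves `hab` and costs only operator norms. -/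
lemma exists_energy_bound [FiniteDimensional ℝ V] {a b : ι → V →L[ℝ] V}
    (hab : ∀ i k w, b i (a k w) + b k (a i w) = if i = k then (2 : ℝ) • w else 0) :
    ∃ C : ℝ, 0 ≤ C ∧ ∀ v : EuclideanSpace ℝ ι → V, ContDiff ℝ ∞ v → HasCompactSupport v →
      ∀ i, ∫ x, ‖pd i v x‖ ^ 2 ≤ C * ∫ x, ‖diracOp a v x‖ ^ 2 := by
  let φ : V ≃L[ℝ] EuclideanSpace ℝ (Fin (Module.finrank ℝ V)) := toEuclidean
  let L : V →L[ℝ] EuclideanSpace ℝ (Fin (Module.finrank ℝ V)) := φ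
  let L' : EuclideanSpace ℝ (Fin (Module.finrank ℝ V)) →L[ℝ] V := φ.symm
  let conj : (V →L[ℝ] V) → EuclideanSpace ℝ (Fin (Module.finrank ℝ V)) →L[ℝ]
      EuclideanSpace ℝ (Fin (Module.finrank ℝ V)) :=
    fun T => L ∘L T ∘L L'
  have hab' : ∀ i k w, conj (b i) (conj (a k) w) + conj (b k) (conj (a i) w) =
      if i = k then (2 : ℝ) • w else 0 := by
    intro i k w
    have := congrArg φ (hab i k (φ.symm w))
    rw [map_add] at this
    simp only [conj, L, L', ContinuousLinearMap.comp_apply, ContinuousLinearEquiv.coe_coe,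
      ContinuousLinearEquiv.symm_apply_apply]
    rw [this]
    split_ifs <;> simp
  refine ⟨‖L'‖ ^ 2 * ((∑ i, ‖conj (b i)‖ ^ 2) * ‖L‖ ^ 2),
    by positivity, fun v hv hc i => ?_⟩
  have hφv : ContDiff ℝ ∞ (fun x => φ (v x)) := φ.contDiff.comp hv
  have hφc : HasCompactSupport (fun x => φ (v x)) := hc.comp_left (map_zero φ)
  have hpd : ∀ i x, pd i (fun x => φ (v x)) x = φ (pd i v x) := fun i x =>
    pd_clm L i (hv.differentiable (by simp) x)
  have hD : ∀ x, diracOp (fun i => conj (a i)) (fun x => φ (v x)) x = φ (diracOp a v x) := by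
    intro x
    simp [diracOp, hpd, conj, L, L', map_sum]
  have h1 := energy_inner hab' hφv hφc
  simp only [hpd, hD] at h1
  have h2 : ∫ x, ‖φ (pd i v x)‖ ^ 2 ≤ ∑ i, ∫ x, ‖φ (pd i v x)‖ ^ 2 :=
    Finset.single_le_sum (f := fun i => ∫ x, ‖φ (pd i v x)‖ ^ 2)
      (fun i _ => integral_nonneg fun x => by positivity) (Finset.mem_univ i)
  have h3 : ∫ x, ‖φ (diracOp a v x)‖ ^ 2 ≤
      ‖L‖ ^ 2 * ∫ x, ‖diracOp a v x‖ ^ 2 := by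
    rw [← integral_const_mul]
    refine integral_mono_of_nonneg (ae_of_all _ fun x => by positivity)
      ((integrable_norm_sq (contDiff_diracOp a hv).continuous
        (hasCompactSupport_diracOp a hc)).const_mul _) (ae_of_all _ fun x => ?_)
    simp only
    rw [← mul_pow]
    gcongr
    exact L.le_opNorm _
  have h4 : ∫ x, ‖pd i v x‖ ^ 2 ≤
      ‖L'‖ ^ 2 * ∫ x, ‖φ (pd i v x)‖ ^ 2 := by
    rw [← integral_const_mul]
    refine integral_mono_of_nonneg (ae_of_all _ fun x => by positivity)
      ((integrable_norm_sq (φ.continuous.comp (contDiff_pd hv i).continuous)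
        ((hasCompactSupport_pd hc i).comp_left (map_zero φ))).const_mul _) (ae_of_all _ fun x => ?_)
    simp only
    rw [← mul_pow]
    gcongr
    simpa [L'] using L'.le_opNorm (φ (pd i v x))
  calc ∫ x, ‖pd i v x‖ ^ 2
      ≤ ‖L'‖ ^ 2 * ∫ x, ‖φ (pd i v x)‖ ^ 2 := h4
    _ ≤ ‖L'‖ ^ 2 * ((∑ i, ‖conj (b i)‖ ^ 2) *
        (‖L‖ ^ 2 * ∫ x, ‖diracOp a v x‖ ^ 2)) := by
      gcongr
      exact h2.trans (h1.trans (by gcongr))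
    _ = _ := by ring

end Integrals

/-! ### Interior estimates for chains. -/

section Estimates

open MeasureTheory

variable {ι : Type*} [Fintype ι] [DecidableEq ι]
variable {V : Type*} [NormedAddCommGroup V] [NormedSpace ℝ V]

/-- A sequence of smooth functions, each of which is mapped to the next one by `diracOp a` on `U`. -/
structure IsDiracChain (a : ι → V →L[ℝ] V) (U : Set (EuclideanSpace ℝ ι))
    (u : ℕ → EuclideanSpace ℝ ι → V) : Prop where
  smooth : ∀ k, ContDiff ℝ ∞ (u k)
  dirac : ∀ k, Set.EqOn (diracOp a (u k)) (u (k + 1)) U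

lemma IsDiracChain.shift {a : ι → V →L[ℝ] V} {U : Set (EuclideanSpace ℝ ι)}
    {u : ℕ → EuclideanSpace ℝ ι → V} (h : IsDiracChain a U u) :
    IsDiracChain a U (fun k => u (k + 1)) :=
  ⟨fun k => h.smooth (k + 1), fun k => h.dirac (k + 1)⟩

lemma IsDiracChain.sub {a : ι → V →L[ℝ] V} {U : Set (EuclideanSpace ℝ ι)}
    {u v : ℕ → EuclideanSpace ℝ ι → V} (hu : IsDiracChain a U u) (hv : IsDiracChain a U v) :
    IsDiracChain a U (fun k x => u k x - v k x) := by
  refine ⟨fun k => (hu.smooth k).sub (hv.smooth k), fun k x hx => ?_⟩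
  have hd : ∀ i, pd i (fun x => u k x - v k x) x = pd i (u k) x - pd i (v k) x := fun i =>
    pd_sub i ((hu.smooth k).differentiable (by simp) x) ((hv.smooth k).differentiable (by simp) x)
  simp only [← hu.dirac k hx, ← hv.dirac k hx, diracOp, hd, map_sub, Finset.sum_sub_distrib]

lemma pd_const_smul (c : ℝ) {f : EuclideanSpace ℝ ι → V} (hf : ContDiff ℝ ∞ f) (i : ι) :
    pd i (fun x => c • f x) = fun x => c • pd i f x := by
  ext x
  exact pd_clm (c • ContinuousLinearMap.id ℝ V) i (hf.differentiable (by simp) x)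

lemma pdList_const_smul (c : ℝ) {f : EuclideanSpace ℝ ι → V} (hf : ContDiff ℝ ∞ f)
    (l : List ι) : pdList l (fun x => c • f x) = fun x => c • pdList l f x := by
  induction l with
  | nil => rfl
  | cons i l ih => rw [pdList_cons, ih, pd_const_smul c (contDiff_pdList hf l), pdList_cons]

lemma IsDiracChain.const_smul {a : ι → V →L[ℝ] V} {U : Set (EuclideanSpace ℝ ι)}
    {u : ℕ → EuclideanSpace ℝ ι → V} (hu : IsDiracChain a U u) (c : ℝ) :
    IsDiracChain a U (fun k x => c • u k x) := by
  refine ⟨fun k => contDiff_const.smul (hu.smooth k), fun k x hx => ?_⟩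
  simp only [← hu.dirac k hx, diracOp, pd_const_smul c (hu.smooth k), map_smul, Finset.smul_sum]

/-- A functional on Dirac chains is controlled if it is bounded by a constant as soon as finitely
many members of the chain are bounded by `1` on a certain compact subset of `U`. -/
def Controlled (a : ι → V →L[ℝ] V) (U : Set (EuclideanSpace ℝ ι))
    (Φ : (ℕ → EuclideanSpace ℝ ι → V) → ℝ) : Prop :=
  ∃ K ⊆ U, IsCompact K ∧ ∃ (p : ℕ) (C : ℝ), ∀ u, IsDiracChain a U u →
    (∀ k ≤ p, ∀ x ∈ K, ‖u k x‖ ≤ 1) → Φ u ≤ C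

namespace Controlled

variable {a : ι → V →L[ℝ] V} {U : Set (EuclideanSpace ℝ ι)}
  {Φ Ψ : (ℕ → EuclideanSpace ℝ ι → V) → ℝ}

lemma mono (hΨ : Controlled a U Ψ) (h : ∀ u, IsDiracChain a U u → Φ u ≤ Ψ u) :
    Controlled a U Φ := by
  obtain ⟨K, hKU, hK, p, C, hC⟩ := hΨ
  exact ⟨K, hKU, hK, p, C, fun u hu hb => (h u hu).trans (hC u hu hb)⟩

lemma const (c : ℝ) : Controlled a U (fun _ => c) :=
  ⟨∅, Set.empty_subset _, isCompact_empty, 0, c, fun _ _ _ => le_rfl⟩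

lemma add (hΦ : Controlled a U Φ) (hΨ : Controlled a U Ψ) :
    Controlled a U (fun u => Φ u + Ψ u) := by
  obtain ⟨K, hKU, hK, p, C, hC⟩ := hΦ
  obtain ⟨K', hKU', hK', p', C', hC'⟩ := hΨ
  refine ⟨K ∪ K', Set.union_subset hKU hKU', hK.union hK', max p p', C + C', fun u hu hb => ?_⟩
  exact add_le_add
    (hC u hu fun k hk x hx => hb k (hk.trans (le_max_left _ _)) x (Or.inl hx))
    (hC' u hu fun k hk x hx => hb k (hk.trans (le_max_right _ _)) x (Or.inr hx))

lemma const_mul (hΦ : Controlled a U Φ) {c : ℝ} (hc : 0 ≤ c) :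
    Controlled a U (fun u => c * Φ u) := by
  obtain ⟨K, hKU, hK, p, C, hC⟩ := hΦ
  exact ⟨K, hKU, hK, p, c * C, fun u hu hb => mul_le_mul_of_nonneg_left (hC u hu hb) hc⟩

/-- One application of the operator is paid for by controlling one more member of the chain, hence
`p + 1`. -/
lemma shift (hΦ : Controlled a U Φ) : Controlled a U (fun u => Φ fun k => u (k + 1)) := by
  obtain ⟨K, hKU, hK, p, C, hC⟩ := hΦ
  exact ⟨K, hKU, hK, p + 1, C, fun u hu hb =>
    hC _ hu.shift fun k hk x hx => hb (k + 1) (by omega) x hx⟩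

lemma sum {κ : Type*} (s : Finset κ) {Φ : κ → (ℕ → EuclideanSpace ℝ ι → V) → ℝ}
    (h : ∀ i ∈ s, Controlled a U (Φ i)) : Controlled a U (fun u => ∑ i ∈ s, Φ i u) := by
  classical
  induction s using Finset.induction_on with
  | empty => simpa using const 0
  | insert i s hi ih =>
    simp only [Finset.sum_insert hi]
    exact (h i (Finset.mem_insert_self _ _)).add
      (ih fun j hj => h j (Finset.mem_insert_of_mem hj))

end Controlled

lemma norm_add_sq_le_two (x y : V) : ‖x + y‖ ^ 2 ≤ 2 * ‖x‖ ^ 2 + 2 * ‖y‖ ^ 2 := by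
  have h := norm_add_le x y
  have h0 := norm_nonneg (x + y)
  nlinarith [sq_nonneg (‖x‖ - ‖y‖)]

lemma integral_norm_add_sq_le {f g : EuclideanSpace ℝ ι → V} (hf : Continuous f)
    (hfc : HasCompactSupport f) (hg : Continuous g) (hgc : HasCompactSupport g) :
    ∫ x, ‖f x + g x‖ ^ 2 ≤ 2 * (∫ x, ‖f x‖ ^ 2) + 2 * ∫ x, ‖g x‖ ^ 2 := by
  have hfi := (integrable_norm_sq hf hfc).const_mul 2
  have hgi := (integrable_norm_sq hg hgc).const_mul 2
  rw [← integral_const_mul, ← integral_const_mul, ← integral_add hfi hgi]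
  exact integral_mono_of_nonneg (ae_of_all _ fun x => by positivity) (hfi.add hgi)
    (ae_of_all _ fun x => norm_add_sq_le_two _ _)

lemma norm_diracOp_smul_sq_le (a : ι → V →L[ℝ] V) {χ : EuclideanSpace ℝ ι → ℝ}
    {f : EuclideanSpace ℝ ι → V} {x : EuclideanSpace ℝ ι} (hχ : DifferentiableAt ℝ χ x)
    (hf : DifferentiableAt ℝ f x) :
    ‖diracOp a (fun y => χ y • f y) x‖ ^ 2 ≤ 2 * ‖χ x • diracOp a f x‖ ^ 2 +
      ∑ k, (2 * Fintype.card ι * ‖a k‖ ^ 2) * ‖pd k χ x • f x‖ ^ 2 := by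
  rw [diracOp_smul a hχ hf]
  refine (norm_add_sq_le_two _ _).trans (add_le_add le_rfl ?_)
  have h1 : ‖∑ k, pd k χ x • a k (f x)‖ ≤ ∑ k, ‖a k‖ * ‖pd k χ x • f x‖ := by
    refine (norm_sum_le _ _).trans (Finset.sum_le_sum fun k _ => ?_)
    rw [← map_smul]
    exact (a k).le_opNorm _
  calc 2 * ‖∑ k, pd k χ x • a k (f x)‖ ^ 2
      ≤ 2 * (∑ k, ‖a k‖ * ‖pd k χ x • f x‖) ^ 2 := by gcongr
    _ ≤ 2 * (Fintype.card ι * ∑ k, (‖a k‖ * ‖pd k χ x • f x‖) ^ 2) := by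
      gcongr
      exact sq_sum_le_card_mul_sum_sq
    _ = _ := by
      rw [Finset.mul_sum, Finset.mul_sum]
      exact Finset.sum_congr rfl fun k _ => by ring

/-- Write `w = ∂^l u_0` and `χ ∂_i w = ∂_i (χ w) - (∂_i χ) w`. The energy bound replaces `∂_i (χ w)`
by `D (χ w) = χ D w + ∑ (∂_k χ) a_k w`, where `D w = ∂^l u_1` on `U`. Every remaining term has one
derivative fewer, at the price of a shift or of a differentiated cutoff; therefore the induction
runs over all `χ`. -/
lemma controlled_integral_smul_pdList [FiniteDimensional ℝ V] {a b : ι → V →L[ℝ] V}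
    (hab : ∀ i k w, b i (a k w) + b k (a i w) = if i = k then (2 : ℝ) • w else 0)
    {U : Set (EuclideanSpace ℝ ι)} (hU : IsOpen U) (l : List ι) {χ : EuclideanSpace ℝ ι → ℝ}
    (hχ : ContDiff ℝ ∞ χ) (hχc : HasCompactSupport χ) (hχU : tsupport χ ⊆ U) :
    Controlled a U (fun u => ∫ x, ‖χ x • pdList l (u 0) x‖ ^ 2) := by
  induction l generalizing χ with
  | nil =>
    refine ⟨tsupport χ, hχU, hχc, 0, ∫ x, ‖χ x‖ ^ 2, fun u hu hb => ?_⟩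
    refine integral_mono_of_nonneg (ae_of_all _ fun x => by positivity)
      (integrable_norm_sq hχ.continuous hχc) (ae_of_all _ fun x => ?_)
    simp only [pdList_nil, norm_smul]
    by_cases hx : x ∈ tsupport χ
    · gcongr
      exact mul_le_of_le_one_right (norm_nonneg _) (hb 0 le_rfl x hx)
    · simp [image_eq_zero_of_notMem_tsupport hx]
  | cons i l ih =>
    obtain ⟨C, hC0, hC⟩ := exists_energy_bound hab
    have hpdχ : ∀ k, Controlled a U (fun u => ∫ x, ‖pd k χ x • pdList l (u 0) x‖ ^ 2) := fun k =>
      ih (contDiff_pd hχ k) (hasCompactSupport_pd hχc k) ((tsupport_pd_subset k χ).trans hχU)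
    have hmain : Controlled a U (fun u => 2 * (C * (2 * (∫ x, ‖χ x • pdList l (u 1) x‖ ^ 2) +
        ∑ k, (2 * Fintype.card ι * ‖a k‖ ^ 2) * ∫ x, ‖pd k χ x • pdList l (u 0) x‖ ^ 2)) +
        2 * ∫ x, ‖pd i χ x • pdList l (u 0) x‖ ^ 2) :=
      (((((ih hχ hχc hχU).shift).const_mul zero_le_two).add (Controlled.sum _ fun k _ =>
        (hpdχ k).const_mul (by positivity))).const_mul hC0 |>.const_mul zero_le_two).add
        ((hpdχ i).const_mul zero_le_two)
    refine hmain.mono fun u hu => ?_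
    set w := pdList l (u 0) with hw_def
    have hw : ContDiff ℝ ∞ w := contDiff_pdList (hu.smooth 0) l
    have hχw : ContDiff ℝ ∞ (fun x => χ x • w x) := hχ.smul hw
    have hχwc : HasCompactSupport (fun x => χ x • w x) := hχc.smul_right
    have hpc : ∀ k, HasCompactSupport (fun x => pd k χ x • w x) := fun k =>
      (hasCompactSupport_pd hχc k).smul_right
    have hpcont : ∀ k, Continuous (fun x => pd k χ x • w x) := fun k =>
      ((contDiff_pd hχ k).smul hw).continuous
    -- The chain relation is only known on `U`; elsewhere the cutoff vanishes.
    have hdirac : ∀ x, χ x • diracOp a w x = χ x • pdList l (u 1) x := by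
      intro x
      by_cases hx : x ∈ U
      · rw [hw_def, ← pdList_diracOp a (hu.smooth 0) l, pdList_eqOn hU (hu.dirac 0) l hx]
      · simp [image_eq_zero_of_notMem_tsupport fun h => hx (hχU h)]
    have h1 : ∫ x, ‖χ x • pdList (i :: l) (u 0) x‖ ^ 2 ≤
        2 * (∫ x, ‖pd i (fun x => χ x • w x) x‖ ^ 2) + 2 * ∫ x, ‖pd i χ x • w x‖ ^ 2 := by
      have := integral_norm_add_sq_le (contDiff_pd hχw i).continuous (hasCompactSupport_pd hχwc i)
        (hpcont i).neg (hpc i).neg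
      simp only [Pi.neg_apply, norm_neg] at this
      refine le_of_eq_of_le ?_ this
      congr 1
      ext x
      rw [pd_smul i (hχ.differentiable (by simp) x) (hw.differentiable (by simp) x),
        pdList_cons, add_neg_cancel_right]
    have h2 : ∫ x, ‖diracOp a (fun x => χ x • w x) x‖ ^ 2 ≤
        2 * (∫ x, ‖χ x • pdList l (u 1) x‖ ^ 2) +
        ∑ k, (2 * Fintype.card ι * ‖a k‖ ^ 2) * ∫ x, ‖pd k χ x • w x‖ ^ 2 := by
      have hi1 : Integrable (fun x => ‖χ x • pdList l (u 1) x‖ ^ 2) :=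
        integrable_norm_sq (hχ.smul (contDiff_pdList (hu.smooth 1) l)).continuous hχc.smul_right
      have hi2 : ∀ k ∈ Finset.univ, Integrable (fun x => (2 * Fintype.card ι * ‖a k‖ ^ 2) *
          ‖pd k χ x • w x‖ ^ 2) := fun k _ =>
        (integrable_norm_sq (hpcont k) (hpc k)).const_mul _
      simp only [← integral_const_mul]
      rw [← integral_finsetSum _ hi2, ← integral_add (hi1.const_mul 2) (integrable_finsetSum _ hi2)]
      refine integral_mono_of_nonneg (ae_of_all _ fun x => by positivity)
        ((hi1.const_mul 2).add (integrable_finsetSum _ hi2)) (ae_of_all _ fun x => ?_)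
      simp only [← hdirac]
      exact norm_diracOp_smul_sq_le a (hχ.differentiable (by simp) x)
        (hw.differentiable (by simp) x)
    have h3 := hC _ hχw hχwc i
    refine h1.trans (add_le_add (mul_le_mul_of_nonneg_left (h3.trans ?_) zero_le_two) le_rfl)
    exact mul_le_mul_of_nonneg_left h2 hC0

/-- The Leibniz rule moves the derivatives in `l` inside the product one at a time. The one next to
the product is the last entry of `l`, whence the reversed induction. -/
lemma controlled_integral_pdList_smul [FiniteDimensional ℝ V] {a b : ι → V →L[ℝ] V}
    (hab : ∀ i k w, b i (a k w) + b k (a i w) = if i = k then (2 : ℝ) • w else 0)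
    {U : Set (EuclideanSpace ℝ ι)} (hU : IsOpen U) (l m : List ι) {χ : EuclideanSpace ℝ ι → ℝ}
    (hχ : ContDiff ℝ ∞ χ) (hχc : HasCompactSupport χ) (hχU : tsupport χ ⊆ U) :
    Controlled a U (fun u => ∫ x, ‖pdList l (fun y => χ y • pdList m (u 0) y) x‖ ^ 2) := by
  induction l using List.reverseRecOn generalizing χ m with
  | nil => exact controlled_integral_smul_pdList hab hU m hχ hχc hχU
  | append_singleton l i ih =>
    refine (((ih (i :: m) hχ hχc hχU).const_mul zero_le_two).add ((ih m (contDiff_pd hχ i)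
      (hasCompactSupport_pd hχc i) ((tsupport_pd_subset i χ).trans hχU)).const_mul
      zero_le_two)).mono fun u hu => ?_
    have hw : ContDiff ℝ ∞ (pdList m (u 0)) := contDiff_pdList (hu.smooth 0) m
    have hs1 : ContDiff ℝ ∞ (fun y => χ y • pdList (i :: m) (u 0) y) := hχ.smul (contDiff_pd hw i)
    have hs2 : ContDiff ℝ ∞ (fun y => pd i χ y • pdList m (u 0) y) := (contDiff_pd hχ i).smul hw
    have heq : pd i (fun y => χ y • pdList m (u 0) y) =
        fun y => χ y • pdList (i :: m) (u 0) y + pd i χ y • pdList m (u 0) y := by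
      ext x
      exact pd_smul i (hχ.differentiable (by simp) x) (hw.differentiable (by simp) x)
    simp only [pdList_append]
    rw [show pdList [i] (fun y => χ y • pdList m (u 0) y) = _ from heq, pdList_add hs1 hs2]
    exact integral_norm_add_sq_le (contDiff_pdList hs1 l).continuous
      (hasCompactSupport_pdList hχc.smul_right l) (contDiff_pdList hs2 l).continuous
      (hasCompactSupport_pdList (hasCompactSupport_pd hχc i).smul_right l)

lemma exists_smooth_cutoff {K U : Set (EuclideanSpace ℝ ι)} (hK : IsCompact K) (hU : IsOpen U)
    (hKU : K ⊆ U) : ∃ χ : EuclideanSpace ℝ ι → ℝ, ContDiff ℝ ∞ χ ∧ HasCompactSupport χ ∧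
      tsupport χ ⊆ U ∧ Set.EqOn χ 1 K := by
  obtain ⟨L, hL, hKL, hLU⟩ := exists_compact_between hK hU hKU
  obtain ⟨χ, h1, h0, -⟩ := exists_contMDiffMap_one_nhds_of_subset_interior (n := ⊤)
    (modelWithCornersSelf ℝ (EuclideanSpace ℝ ι)) hK.isClosed hKL
  have hs : tsupport χ ⊆ L := closure_minimal
    (fun x hx => by by_contra h; exact hx (h0 x h)) hL.isClosed
  exact ⟨χ, χ.contMDiff.contDiff, hL.of_isClosed_subset (isClosed_tsupport _) hs, hs.trans hLU,
    fun x hx => h1.self_of_nhdsSet x hx⟩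

/-- Interior estimate: the derivatives of the first member of a Dirac chain are controlled,
uniformly on compact sets, by finitely many members of the chain. -/
lemma exists_norm_pdList_le [FiniteDimensional ℝ V] {a b : ι → V →L[ℝ] V}
    (hab : ∀ i k w, b i (a k w) + b k (a i w) = if i = k then (2 : ℝ) • w else 0)
    {K U : Set (EuclideanSpace ℝ ι)} (hK : IsCompact K) (hU : IsOpen U) (hKU : K ⊆ U)
    (m : List ι) :
    ∃ K' ⊆ U, IsCompact K' ∧ ∃ (p : ℕ) (C : ℝ), ∀ u, IsDiracChain a U u → ∀ ε > 0,
      (∀ k ≤ p, ∀ x ∈ K', ‖u k x‖ ≤ ε) → ∀ x ∈ K, ‖pdList m (u 0) x‖ ≤ C * ε := by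
  obtain ⟨χ, hχ, hχc, hχU, hχ1⟩ := exists_smooth_cutoff hK hU hKU
  set l := (Finset.univ : Finset ι).toList
  obtain ⟨K', hKU', hK', p, C, hC⟩ := controlled_integral_pdList_smul hab hU l m hχ hχc hχU
  -- The case `ε = 1`; the general case follows by homogeneity, rescaling the chain by `ε⁻¹`.
  have hunit : ∀ u, IsDiracChain a U u → (∀ k ≤ p, ∀ x ∈ K', ‖u k x‖ ≤ 1) →
      ∀ x ∈ K, ‖pdList m (u 0) x‖ ≤ volume.real (tsupport χ) + C := by
    intro u hu hb x hx
    have hw : ContDiff ℝ ∞ (fun y => χ y • pdList m (u 0) y) :=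
      hχ.smul (contDiff_pdList (hu.smooth 0) m)
    have hwc : HasCompactSupport (fun y => χ y • pdList m (u 0) y) := hχc.smul_right
    have h1 := norm_le_integral_pdList hw hwc x
    simp only [hχ1 hx, Pi.one_apply, one_smul] at h1
    set g := pdList l (fun y => χ y • pdList m (u 0) y)
    have hgs : tsupport g ⊆ tsupport χ :=
      (tsupport_pdList_subset l _).trans (closure_mono (Function.support_smul_subset_left _ _))
    have hi2 : Integrable (fun x => ‖g x‖ ^ 2) :=
      integrable_norm_sq (contDiff_pdList hw l).continuous (hasCompactSupport_pdList hwc l)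
    have hi1 : Integrable ((tsupport χ).indicator (fun _ : EuclideanSpace ℝ ι => (1 : ℝ))) :=
      (integrable_indicator_iff (isClosed_tsupport χ).measurableSet).2
        (integrableOn_const hχc.measure_lt_top.ne)
    -- On the support of the cutoff, `t ≤ 1 + t²` passes from `L²` to `L¹`; the volume of that
    -- support is the additive constant.
    have h2 : ∫ y, ‖g y‖ ≤
        ∫ y, ((tsupport χ).indicator (fun _ : EuclideanSpace ℝ ι => (1 : ℝ)) y + ‖g y‖ ^ 2) := by
      refine integral_mono_of_nonneg (ae_of_all _ fun x => norm_nonneg _) (hi1.add hi2)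
        (ae_of_all _ fun y => ?_)
      by_cases hy : y ∈ tsupport χ
      · simp only [Set.indicator_of_mem hy]
        nlinarith [sq_nonneg (‖g y‖ - 1), norm_nonneg (g y)]
      · simp [Set.indicator_of_notMem hy, image_eq_zero_of_notMem_tsupport fun h => hy (hgs h)]
    rw [integral_add hi1 hi2, integral_indicator_const _ (isClosed_tsupport χ).measurableSet,
      smul_eq_mul, mul_one] at h2
    exact h1.trans (h2.trans (add_le_add le_rfl (hC u hu hb)))
  refine ⟨K', hKU', hK', p, volume.real (tsupport χ) + C, fun u hu ε hε hb x hx => ?_⟩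
  have h := hunit _ (hu.const_smul ε⁻¹) (fun k hk x hx => by
    rw [norm_smul, norm_inv, Real.norm_of_nonneg hε.le]
    exact inv_mul_le_one_of_le₀ (hb k hk x hx) hε.le) x hx
  simp only [pdList_const_smul _ (hu.smooth 0)] at h
  rwa [norm_smul, norm_inv, Real.norm_of_nonneg hε.le, inv_mul_le_iff₀ hε, mul_comm] at h

end Estimates

/-! ### Passage to the limit in smooth chains. -/

section Limits

variable {ι : Type*} [Fintype ι] [DecidableEq ι]
variable {V : Type*} [NormedAddCommGroup V] [NormedSpace ℝ V]

lemma tendstoUniformlyOn_sum {κ α β W : Type*} [NormedAddCommGroup W] {l : Filter β} {K : Set α}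
    (s : Finset κ) {F : κ → β → α → W} {f : κ → α → W}
    (h : ∀ i ∈ s, TendstoUniformlyOn (F i) (f i) l K) :
    TendstoUniformlyOn (fun j x => ∑ i ∈ s, F i j x) (fun x => ∑ i ∈ s, f i x) l K := by
  classical
  induction s using Finset.induction_on with
  | empty =>
    simp only [Finset.sum_empty]
    exact fun u hu => Eventually.of_forall fun _ _ _ => refl_mem_uniformity hu
  | insert i s hi ih =>
    simp only [Finset.sum_insert hi]
    exact (h i (Finset.mem_insert_self _ _)).add
      (ih fun j hj => h j (Finset.mem_insert_of_mem hj))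

/-- The continuous linear map sending `w` to `v ↦ v i • w`. -/
noncomputable def coordSmul (i : ι) : V →L[ℝ] EuclideanSpace ℝ ι →L[ℝ] V :=
  ContinuousLinearMap.smulRightL ℝ (EuclideanSpace ℝ ι) V (EuclideanSpace.proj i)

lemma coordSmul_apply (i : ι) (w : V) (v : EuclideanSpace ℝ ι) : coordSmul i w v = v i • w := rfl

lemma fderiv_eq_sum_coordSmul (f : EuclideanSpace ℝ ι → V) (x : EuclideanSpace ℝ ι) :
    fderiv ℝ f x = ∑ i, coordSmul i (pd i f x) := by
  ext v
  rw [_root_.sum_apply]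
  simp only [coordSmul_apply, pd, ← map_smul]
  rw [← map_sum]
  congr 1
  ext j
  simp [Finset.sum_apply, Pi.single_apply]

lemma pd_of_hasFDerivAt_sum_coordSmul {f : EuclideanSpace ℝ ι → V} {x : EuclideanSpace ℝ ι}
    {w : ι → V} (h : HasFDerivAt f (∑ i, coordSmul i (w i)) x) (i : ι) : pd i f x = w i := by
  rw [pd, h.fderiv, _root_.sum_apply, Finset.sum_eq_single i]
  · simp [coordSmul_apply]
  · intro j _ hj
    simp [coordSmul_apply, hj]
  · simp

/-- If all iterated partial derivatives of a sequence of smooth functions converge uniformly on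
compact subsets of an open set, then the limit is smooth and the limits of the derivatives are the
derivatives of the limit. -/
lemma contDiffOn_of_tendstoUniformlyOn_pdList {U : Set (EuclideanSpace ℝ ι)} (hU : IsOpen U)
    {u : ℕ → EuclideanSpace ℝ ι → V} (hu : ∀ j, ContDiff ℝ ∞ (u j))
    {h : List ι → EuclideanSpace ℝ ι → V}
    (hh : ∀ l, ∀ K ⊆ U, IsCompact K → TendstoUniformlyOn (fun j => pdList l (u j)) (h l) atTop K) :
    ContDiffOn ℝ ∞ (h []) U ∧ ∀ l, Set.EqOn (pdList l (h [])) (h l) U := by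
  have hderiv : ∀ l, ∀ x ∈ U, HasFDerivAt (h l) (∑ i, coordSmul i (h (i :: l) x)) x := by
    intro l x hx
    refine hasFDerivAt_of_tendstoLocallyUniformlyOn (l := atTop) (f := fun j => pdList l (u j))
      (f' := fun j y => ∑ i, coordSmul i (pdList (i :: l) (u j) y))
      (g' := fun y => ∑ i, coordSmul i (h (i :: l) y)) hU ?_ ?_ ?_ hx
    · rw [tendstoLocallyUniformlyOn_iff_forall_isCompact hU]
      intro K hKU hK
      refine tendstoUniformlyOn_sum _ fun i _ => ?_
      exact (coordSmul i).uniformContinuous.comp_tendstoUniformlyOn (hh (i :: l) K hKU hK)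
    · intro j y _
      have := ((contDiff_pdList (hu j) l).differentiable (by simp) y).hasFDerivAt
      rwa [fderiv_eq_sum_coordSmul] at this
    · intro y hy
      exact (hh l {y} (by simpa using hy) isCompact_singleton).tendsto_at (Set.mem_singleton y)
  have hpd : ∀ l i, Set.EqOn (pd i (h l)) (h (i :: l)) U := fun l i x hx =>
    pd_of_hasFDerivAt_sum_coordSmul (hderiv l x hx) i
  refine ⟨contDiffOn_infty.2 fun n => ?_, fun l => ?_⟩
  -- The derivative of `h l` is built from the `h (i :: l)`, so the induction on `n` must treat all
  -- `l` together.
  · suffices ∀ n : ℕ, ∀ l, ContDiffOn ℝ n (h l) U from this n []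
    intro n
    induction n with
    | zero =>
      intro l
      rw [Nat.cast_zero, contDiffOn_zero]
      exact fun x hx => (hderiv l x hx).continuousAt.continuousWithinAt
    | succ n ih =>
      intro l
      rw [Nat.cast_succ, contDiffOn_succ_iff_fderiv_of_isOpen hU]
      refine ⟨fun x hx => (hderiv l x hx).differentiableAt.differentiableWithinAt, by simp, ?_⟩
      have : ContDiffOn ℝ n (fun x => ∑ i, coordSmul i (h (i :: l) x)) U :=
        ContDiffOn.sum fun i _ =>
          (coordSmul (V := V) i).contDiff.comp_contDiffOn (ih (i :: l))
      exact this.congr fun x hx => (hderiv l x hx).fderiv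
  · induction l with
    | nil => exact fun _ _ => rfl
    | cons i l ih => exact fun x hx => (pd_eqOn hU ih i hx).trans (hpd l i hx)

variable [FiniteDimensional ℝ V] {a b : ι → V →L[ℝ] V}

/-- The difference of two chains is a chain, so the interior estimate applies to it. -/
lemma uniformCauchySeqOn_pdList
    (hab : ∀ i k w, b i (a k w) + b k (a i w) = if i = k then (2 : ℝ) • w else 0)
    {U : Set (EuclideanSpace ℝ ι)} (hU : IsOpen U) {u : ℕ → ℕ → EuclideanSpace ℝ ι → V}
    (hu : ∀ j, IsDiracChain a U (u j))
    (hc : ∀ k, ∀ K ⊆ U, IsCompact K → UniformCauchySeqOn (fun j => u j k) atTop K)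
    (l : List ι) {K : Set (EuclideanSpace ℝ ι)} (hKU : K ⊆ U) (hK : IsCompact K) :
    UniformCauchySeqOn (fun j => pdList l (u j 0)) atTop K := by
  obtain ⟨K', hKU', hK', p, C, hC⟩ := exists_norm_pdList_le hab hK hU hKU l
  intro s hs
  obtain ⟨ε, hε, hεs⟩ := Metric.mem_uniformity_dist.1 hs
  -- The denominator is positive whatever the sign of `C`, and `C * δ ≤ ε / 2`.
  set δ := ε / (2 * (|C| + 1)) with hδ_def
  have hδ : 0 < δ := by positivity
  have hall : ∀ᶠ m : ℕ × ℕ in atTop ×ˢ atTop, ∀ k ∈ Finset.range (p + 1), ∀ x ∈ K',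
      (u m.1 k x, u m.2 k x) ∈ {q : V × V | dist q.1 q.2 < δ} :=
    (eventually_all_finset _).2 fun k _ => hc k K' hKU' hK' _ (Metric.dist_mem_uniformity hδ)
  filter_upwards [hall] with m hm x hx
  apply hεs
  have h := hC _ ((hu m.1).sub (hu m.2)) δ hδ (fun k hk y hy => by
    rw [← dist_eq_norm]
    exact (hm k (Finset.mem_range.2 (by omega)) y hy).le) x hx
  rw [pdList_sub ((hu m.1).smooth 0) ((hu m.2).smooth 0)] at h
  rw [dist_eq_norm]
  refine h.trans_lt ?_
  have : C * δ ≤ (|C| + 1) * δ := by gcongr; linarith [le_abs_self C]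
  refine this.trans_lt ?_
  rw [hδ_def]
  field_simp
  linarith

/-- Locally uniform limits of Dirac chains are smooth, and all derivatives converge. -/
lemma contDiffOn_and_tendstoUniformlyOn_of_isDiracChain
    (hab : ∀ i k w, b i (a k w) + b k (a i w) = if i = k then (2 : ℝ) • w else 0)
    {U : Set (EuclideanSpace ℝ ι)} (hU : IsOpen U) {u : ℕ → ℕ → EuclideanSpace ℝ ι → V}
    (hu : ∀ j, IsDiracChain a U (u j)) {g : ℕ → EuclideanSpace ℝ ι → V}
    (hg : ∀ k, ∀ K ⊆ U, IsCompact K → TendstoUniformlyOn (fun j => u j k) (g k) atTop K) :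
    ContDiffOn ℝ ∞ (g 0) U ∧ ∀ l, ∀ K ⊆ U, IsCompact K →
      TendstoUniformlyOn (fun j => pdList l (u j 0)) (pdList l (g 0)) atTop K := by
  have hcauchy := fun (l : List ι) (K : Set (EuclideanSpace ℝ ι)) (hKU : K ⊆ U)
      (hK : IsCompact K) => uniformCauchySeqOn_pdList hab hU hu
    (fun k K hKU hK => (hg k K hKU hK).uniformCauchySeqOn) l hKU hK
  have hlim : ∀ l x, ∃ y, x ∈ U → Tendsto (fun j => pdList l (u j 0) x) atTop (𝓝 y) := by
    intro l x
    by_cases hx : x ∈ U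
    · obtain ⟨y, hy⟩ := cauchySeq_tendsto_of_complete
        ((hcauchy l {x} (by simpa using hx) isCompact_singleton).cauchySeq (Set.mem_singleton x))
      exact ⟨y, fun _ => hy⟩
    · exact ⟨0, fun h => absurd h hx⟩
  choose h hh using hlim
  have hunif : ∀ l, ∀ K ⊆ U, IsCompact K →
      TendstoUniformlyOn (fun j => pdList l (u j 0)) (h l) atTop K := fun l K hKU hK =>
    (hcauchy l K hKU hK).tendstoUniformlyOn_of_tendsto fun x hx => hh l x (hKU hx)
  obtain ⟨hsmooth, heq⟩ := contDiffOn_of_tendstoUniformlyOn_pdList hU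
    (fun j => (hu j).smooth 0) hunif
  have hg0 : Set.EqOn (g 0) (h []) U := fun x hx => tendsto_nhds_unique
    ((hg 0 {x} (by simpa using hx) isCompact_singleton).tendsto_at (Set.mem_singleton x))
    (hh [] x hx)
  refine ⟨hsmooth.congr hg0, fun l K hKU hK => (hunif l K hKU hK).congr_right fun x hx => ?_⟩
  exact (heq l (hKU hx)).symm.trans (pdList_eqOn hU hg0 l (hKU hx)).symm

end Limits

/-! ### Smoothness of `C^1` chains by mollification, and local-to-global limits. -/

section Regularity

open MeasureTheory Convolution

variable {ι : Type*} [Fintype ι] [DecidableEq ι]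
variable {V : Type*} [NormedAddCommGroup V] [NormedSpace ℝ V]

lemma contDiff_smul_of_tsupport_subset {r : WithTop ℕ∞} {Ω : Set (EuclideanSpace ℝ ι)}
    (hΩ : IsOpen Ω) {χ : EuclideanSpace ℝ ι → ℝ} {g : EuclideanSpace ℝ ι → V}
    (hχ : ContDiff ℝ r χ) (hχΩ : tsupport χ ⊆ Ω) (hg : ContDiffOn ℝ r g Ω) :
    ContDiff ℝ r (fun x => χ x • g x) := by
  refine contDiff_iff_contDiffAt.2 fun x => ?_
  by_cases hx : x ∈ Ω
  · exact hχ.contDiffAt.smul (hg.contDiffAt (hΩ.mem_nhds hx))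
  · have : (fun x => χ x • g x) =ᶠ[𝓝 x] fun _ => 0 := by
      filter_upwards [notMem_tsupport_iff_eventuallyEq.1 fun h => hx (hχΩ h)] with y hy
      simp [hy]
    exact contDiffAt_const.congr_of_eventuallyEq this

lemma diracOp_eqOn (a : ι → V →L[ℝ] V) {f g : EuclideanSpace ℝ ι → V}
    {U : Set (EuclideanSpace ℝ ι)} (hU : IsOpen U) (h : Set.EqOn f g U) :
    Set.EqOn (diracOp a f) (diracOp a g) U := fun x hx => by
  simp only [diracOp, pd_eqOn hU h _ hx]

variable [FiniteDimensional ℝ V]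

-- The derivative is put on `w` rather than on the kernel, so that the chain relation for `w` can be
-- used under the integral.
open ContinuousLinearMap in
lemma diracOp_convolution (a : ι → V →L[ℝ] V) {φ : EuclideanSpace ℝ ι → ℝ} (hφ : Continuous φ)
    (hφc : HasCompactSupport φ) {w : EuclideanSpace ℝ ι → V} (hw : ContDiff ℝ 1 w)
    (hwc : HasCompactSupport w) (y : EuclideanSpace ℝ ι) :
    diracOp a (φ ⋆[lsmul ℝ ℝ, volume] w) y = ∫ t, φ t • diracOp a w (y - t) := by
  have hpd : ∀ i, pd i (φ ⋆[lsmul ℝ ℝ, volume] w) y = ∫ t, φ t • pd i w (y - t) := by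
    intro i
    rw [pd, (hwc.hasFDerivAt_convolution_right (lsmul ℝ ℝ) hφ.locallyIntegrable hw y).fderiv,
      convolution_precompR_apply _ hφ.locallyIntegrable (hwc.fderiv ℝ)
        (hw.continuous_fderiv one_ne_zero)]
    rfl
  have hint : ∀ i, Integrable (fun t => φ t • pd i w (y - t)) := by
    intro i
    have hc : Continuous (pd i w) := (hw.continuous_fderiv one_ne_zero).clm_apply continuous_const
    exact (hφ.smul (hc.comp (continuous_const.sub continuous_id))).integrable_of_hasCompactSupport
      hφc.smul_right
  have hint' : ∀ i ∈ Finset.univ, Integrable (fun t => a i (φ t • pd i w (y - t))) := fun i _ =>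
    (a i).integrable_comp (hint i)
  simp only [diracOp, hpd]
  simp_rw [← ContinuousLinearMap.integral_comp_comm _ (hint _)]
  rw [← integral_finsetSum _ hint']
  simp only [map_smul, Finset.smul_sum]

/-- A bump function at the origin, supported in the ball of radius `r / (j + 1)`. -/
noncomputable def mollifier (r : ℝ) (hr : 0 < r) (j : ℕ) :
    ContDiffBump (0 : EuclideanSpace ℝ ι) where
  rIn := r / (2 * (j + 1))
  rOut := r / (j + 1)
  rIn_pos := by positivity
  rIn_lt_rOut := by
    have : (0 : ℝ) < j + 1 := by positivity
    apply div_lt_div_of_pos_left hr this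
    linarith

open ContinuousLinearMap in
lemma tendstoUniformlyOn_mollify {r : ℝ} (hr : 0 < r) {w : EuclideanSpace ℝ ι → V}
    (hw : Continuous w) (hwc : HasCompactSupport w) (K : Set (EuclideanSpace ℝ ι)) :
    TendstoUniformlyOn (fun j => (mollifier (ι := ι) r hr j).normed volume ⋆[lsmul ℝ ℝ, volume] w) w
      atTop K := by
  rw [Metric.tendstoUniformlyOn_iff]
  intro ε hε
  have huc : UniformContinuous w := hwc.uniformContinuous_of_continuous hw
  obtain ⟨δ, hδ, hδε⟩ := Metric.uniformContinuous_iff.1 huc (ε / 2) (half_pos hε)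
  have hlim : Tendsto (fun j : ℕ => r / ((j : ℝ) + 1)) atTop (𝓝 0) :=
    tendsto_const_nhds.div_atTop (tendsto_atTop_add_const_right _ _ tendsto_natCast_atTop_atTop)
  filter_upwards [hlim.eventually (gt_mem_nhds hδ)] with j hj x _
  rw [dist_comm]
  refine lt_of_le_of_lt ?_ (half_lt_self hε)
  refine (mollifier (ι := ι) r hr j).dist_normed_convolution_le hw.aestronglyMeasurable fun y hy => ?_
  exact (hδε (lt_trans (Metric.mem_ball.1 hy) hj)).le

variable {a b : ι → V →L[ℝ] V}

open ContinuousLinearMap in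
/-- Regularity: a sequence of `C^1` functions, each of which is mapped to the next one by
`diracOp a`, consists of smooth functions. -/
lemma contDiffOn_infty_of_diracOp
    (hab : ∀ i k w, b i (a k w) + b k (a i w) = if i = k then (2 : ℝ) • w else 0)
    {Ω : Set (EuclideanSpace ℝ ι)} (hΩ : IsOpen Ω) {g : ℕ → EuclideanSpace ℝ ι → V}
    (hg : ∀ k, ContDiffOn ℝ 1 (g k) Ω) (hD : ∀ k, Set.EqOn (diracOp a (g k)) (g (k + 1)) Ω) :
    ContDiffOn ℝ ∞ (g 0) Ω := by
  intro x hx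
  obtain ⟨s, hs, hsΩ⟩ := Metric.nhds_basis_closedBall.mem_iff.1 (hΩ.mem_nhds hx)
  -- All mollifiers have radius at most `r`, so averaging around a point of `ball x r` only sees
  -- `ball x s`, where `χ = 1` and the chain relation survives the cutoff.
  set r := s / 2 with hr_def
  have hr : 0 < r := half_pos hs
  obtain ⟨χ, hχ, hχc, hχΩ, hχ1⟩ := exists_smooth_cutoff (isCompact_closedBall x s) hΩ hsΩ
  set w : ℕ → EuclideanSpace ℝ ι → V := fun k y => χ y • g k y with hw_def
  have hw : ∀ k, ContDiff ℝ 1 (w k) := fun k =>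
    contDiff_smul_of_tsupport_subset hΩ (hχ.of_le (by simp)) hχΩ (hg k)
  have hwc : ∀ k, HasCompactSupport (w k) := fun k => hχc.smul_right
  have hwg : ∀ k, Set.EqOn (w k) (g k) (Metric.ball x s) := fun k y hy => by
    simp [hw_def, hχ1 (Metric.ball_subset_closedBall hy)]
  have hDw : ∀ k, Set.EqOn (diracOp a (w k)) (w (k + 1)) (Metric.ball x s) := fun k y hy => by
    rw [diracOp_eqOn a Metric.isOpen_ball (hwg k) hy, hwg (k + 1) hy]
    exact hD k (hsΩ (Metric.ball_subset_closedBall hy))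
  have hchain : ∀ j, IsDiracChain a (Metric.ball x r)
      (fun k => (mollifier (ι := ι) r hr j).normed volume ⋆[lsmul ℝ ℝ, volume] w k) := by
    intro j
    refine ⟨fun k => (mollifier (ι := ι) r hr j).hasCompactSupport_normed.contDiff_convolution_left _
      (mollifier (ι := ι) r hr j).contDiff_normed (hw k).continuous.locallyIntegrable, fun k y hy => ?_⟩
    rw [diracOp_convolution a (mollifier (ι := ι) r hr j).continuous_normed
      (mollifier (ι := ι) r hr j).hasCompactSupport_normed (hw k) (hwc k), convolution_def]
    congr 1
    ext1 t
    by_cases ht : t ∈ Metric.ball (0 : EuclideanSpace ℝ ι) (mollifier (ι := ι) r hr j).rOut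
    · have hyt : y - t ∈ Metric.ball x s := by
        have h1 : ‖t‖ < r := by
          refine (mem_ball_zero_iff.1 ht).trans_le ?_
          exact div_le_self hr.le (by simp)
        have h2 : ‖y - x‖ < r := mem_ball_iff_norm.1 hy
        rw [mem_ball_iff_norm, show y - t - x = (y - x) - t by abel]
        refine (norm_sub_le _ _).trans_lt ?_
        rw [show s = r + r by rw [hr_def]; ring]
        exact add_lt_add h2 h1
      rw [hDw k hyt]
      rfl
    · have : (mollifier (ι := ι) r hr j).normed volume t = 0 := by
        rw [← (mollifier (ι := ι) r hr j).support_normed_eq (μ := volume)] at ht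
        exact Function.notMem_support.1 ht
      simp [this]
  -- The mollified functions form smooth chains converging uniformly to the `w k`, so the limit
  -- theorem makes `w 0` smooth.
  have hsmooth := (contDiffOn_and_tendstoUniformlyOn_of_isDiracChain hab Metric.isOpen_ball hchain
    (g := w) fun k K _ _ => tendstoUniformlyOn_mollify hr (hw k).continuous (hwc k) K).1
  have hat : ContDiffAt ℝ ∞ (w 0) x := hsmooth.contDiffAt (Metric.ball_mem_nhds x hr)
  exact (hat.congr_of_eventuallyEq (Filter.eventuallyEq_of_mem (Metric.ball_mem_nhds x hs)
    (hwg 0).symm)).contDiffWithinAt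

/-- Locally uniform limits of sequences of `C^1` functions that are mapped to each other by
`diracOp a` on an open set. -/
lemma tendstoUniformlyOn_pdList_of_diracOp
    (hab : ∀ i k w, b i (a k w) + b k (a i w) = if i = k then (2 : ℝ) • w else 0)
    {Ω : Set (EuclideanSpace ℝ ι)} (hΩ : IsOpen Ω) {u : ℕ → ℕ → EuclideanSpace ℝ ι → V}
    (hu : ∀ j k, ContDiffOn ℝ 1 (u j k) Ω)
    (hD : ∀ j k, Set.EqOn (diracOp a (u j k)) (u j (k + 1)) Ω) {g : ℕ → EuclideanSpace ℝ ι → V}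
    (hg : ∀ k, ∀ K ⊆ Ω, IsCompact K → TendstoUniformlyOn (fun j => u j k) (g k) atTop K) :
    ContDiffOn ℝ ∞ (g 0) Ω ∧ Set.EqOn (diracOp a (g 0)) (g 1) Ω ∧ ∀ l, ∀ K ⊆ Ω, IsCompact K →
      TendstoUniformlyOn (fun j => pdList l (u j 0)) (pdList l (g 0)) atTop K := by
  have hsmooth : ∀ j k, ContDiffOn ℝ ∞ (u j k) Ω := fun j k =>
    contDiffOn_infty_of_diracOp hab hΩ (g := fun i => u j (k + i)) (fun i => hu j (k + i))
      fun i => hD j (k + i)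
  -- `IsDiracChain` asks for functions smooth on the whole space, so the statement is first proved
  -- near each point, after a cutoff.
  have hloc : ∀ x ∈ Ω, ContDiffAt ℝ ∞ (g 0) x ∧ ∃ K ∈ 𝓝 x, ∀ l,
      TendstoUniformlyOn (fun j => pdList l (u j 0)) (pdList l (g 0)) atTop K := by
    intro x hx
    obtain ⟨s, hs, hsΩ⟩ := Metric.nhds_basis_closedBall.mem_iff.1 (hΩ.mem_nhds hx)
    obtain ⟨χ, hχ, hχc, hχΩ, hχ1⟩ := exists_smooth_cutoff (isCompact_closedBall x s) hΩ hsΩ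
    have heq : ∀ f : EuclideanSpace ℝ ι → V,
        Set.EqOn (fun y => χ y • f y) f (Metric.ball x s) := fun f y hy => by
      simp [hχ1 (Metric.ball_subset_closedBall hy)]
    have hball : Metric.ball x s ⊆ Ω := Metric.ball_subset_closedBall.trans hsΩ
    have hchain : ∀ j, IsDiracChain a (Metric.ball x s) (fun k y => χ y • u j k y) := by
      refine fun j => ⟨fun k => contDiff_smul_of_tsupport_subset hΩ hχ hχΩ (hsmooth j k),
        fun k y hy => ?_⟩
      rw [diracOp_eqOn a Metric.isOpen_ball (heq _) hy]
      exact (hD j k (hball hy)).trans (heq (u j (k + 1)) hy).symm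
    obtain ⟨h1, h2⟩ := contDiffOn_and_tendstoUniformlyOn_of_isDiracChain hab Metric.isOpen_ball
      hchain (g := g) fun k K hK hKc => (hg k K (hK.trans hball) hKc).congr
        (Eventually.of_forall fun j y hy => (heq (u j k) (hK hy)).symm)
    refine ⟨h1.contDiffAt (Metric.ball_mem_nhds x hs), Metric.closedBall x (s / 2),
      Metric.closedBall_mem_nhds x (half_pos hs), fun l => ?_⟩
    have hsub : Metric.closedBall x (s / 2) ⊆ Metric.ball x s :=
      Metric.closedBall_subset_ball (half_lt_self hs)
    exact (h2 l _ hsub (isCompact_closedBall _ _)).congr (Eventually.of_forall fun j y hy =>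
      pdList_eqOn Metric.isOpen_ball (heq (u j 0)) l (hsub hy))
  have hunif : ∀ l, ∀ K ⊆ Ω, IsCompact K →
      TendstoUniformlyOn (fun j => pdList l (u j 0)) (pdList l (g 0)) atTop K := by
    intro l
    rw [← tendstoLocallyUniformlyOn_iff_forall_isCompact hΩ]
    intro s hs x hx
    obtain ⟨-, K, hK, h⟩ := hloc x hx
    exact ⟨K, mem_nhdsWithin_of_mem_nhds hK, h l s hs⟩
  refine ⟨fun x hx => (hloc x hx).1.contDiffWithinAt, fun x hx => ?_, hunif⟩
  have hx' : ({x} : Set (EuclideanSpace ℝ ι)) ⊆ Ω := by simpa using hx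
  -- Convergence of first derivatives lets the relation `D u_0 = u_1` pass to the limit.
  have h1 : Tendsto (fun j => diracOp a (u j 0) x) atTop (𝓝 (diracOp a (g 0) x)) :=
    tendsto_finsetSum _ fun i _ => ((a i).continuous.tendsto _).comp
      ((hunif [i] {x} hx' isCompact_singleton).tendsto_at (Set.mem_singleton x))
  have h2 : Tendsto (fun j => diracOp a (u j 0) x) atTop (𝓝 (g 1 x)) := by
    refine ((hg 1 {x} hx' isCompact_singleton).tendsto_at (Set.mem_singleton x)).congr fun j => ?_
    exact (hD j 0 hx).symm
  exact tendsto_nhds_unique h1 h2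

end Regularity

/-! ### The Clifford relations as ellipticity of the Cauchy-Riemann operator. -/

section Clifford

variable {n : ℕ}

lemma gen_mul_add_swap (i j : Fin n) :
    (gen i * gen j + gen j * gen i : Cl n) =
      algebraMap ℝ (Cl n) (if i = j then -2 else 0) := by
  rw [gen, gen, CliffordAlgebra.ι_mul_ι_add_swap]
  congr 1
  simp only [QuadraticMap.polar, negForm, QuadraticMap.weightedSumSquares_apply, smul_eq_mul,
    Pi.add_apply, ← Finset.sum_sub_distrib]
  have h : ∀ k, -1 * (((Pi.single i 1 : Fin n → ℝ) k + (Pi.single j 1 : Fin n → ℝ) k) *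
      ((Pi.single i 1 : Fin n → ℝ) k + (Pi.single j 1 : Fin n → ℝ) k)) -
      -1 * ((Pi.single i 1 : Fin n → ℝ) k * (Pi.single i 1 : Fin n → ℝ) k) -
      -1 * ((Pi.single j 1 : Fin n → ℝ) k * (Pi.single j 1 : Fin n → ℝ) k) =
      (Pi.single i (-2) : Fin n → ℝ) k * (Pi.single j 1 : Fin n → ℝ) k := by
    intro k
    rcases eq_or_ne k i with rfl | hk
    · simp only [Pi.single_eq_same]; ring
    · simp [Pi.single_eq_of_ne hk]
  rw [Finset.sum_congr rfl fun k _ => h k]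
  simp [Pi.single_apply, eq_comm]

variable {V : Type*} [NormedAddCommGroup V] [NormedSpace ℝ V] [FiniteDimensional ℝ V]
  [Module (Cl n) V] [IsScalarTower ℝ (Cl n) V]

/-- The action of the generator `e j` on `V` as a continuous linear map. -/
noncomputable def genAction (V : Type*) [NormedAddCommGroup V] [NormedSpace ℝ V]
    [FiniteDimensional ℝ V] [Module (Cl n) V] [IsScalarTower ℝ (Cl n) V] (j : Fin n) : V →L[ℝ] V :=
  LinearMap.toContinuousLinearMap (Algebra.lsmul ℝ ℝ V (gen j : Cl n))

lemma genAction_apply (j : Fin n) (v : V) : genAction V j v = (gen j : Cl n) • v := rfl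

/-- The coefficients `1, -e 1, …, -e n` of the generalized Cauchy-Riemann operator. -/
noncomputable def crCoeff (V : Type*) [NormedAddCommGroup V] [NormedSpace ℝ V]
    [FiniteDimensional ℝ V] [Module (Cl n) V] [IsScalarTower ℝ (Cl n) V] :
    Fin (n + 1) → V →L[ℝ] V :=
  Fin.cons (ContinuousLinearMap.id ℝ V) fun j => -genAction V j

/-- The coefficients `1, e 1, …, e n` of the conjugate Cauchy-Riemann operator. -/
noncomputable def crConjCoeff (V : Type*) [NormedAddCommGroup V] [NormedSpace ℝ V]
    [FiniteDimensional ℝ V] [Module (Cl n) V] [IsScalarTower ℝ (Cl n) V] :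
    Fin (n + 1) → V →L[ℝ] V :=
  Fin.cons (ContinuousLinearMap.id ℝ V) fun j => genAction V j

/-- The conjugate operator times `D` is the Laplacian: this is the hypothesis `hab` of all the
estimates. The terms with index `0` cancel by the opposite signs, the others by anticommutation. -/
lemma crConjCoeff_crCoeff (i k : Fin (n + 1)) (w : V) :
    crConjCoeff V i (crCoeff V k w) + crConjCoeff V k (crCoeff V i w) =
      if i = k then (2 : ℝ) • w else 0 := by
  refine Fin.cases ?_ (fun i => ?_) i <;> refine Fin.cases ?_ (fun k => ?_) k
  · simp [crCoeff, crConjCoeff, two_smul]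
  · simp [crCoeff, crConjCoeff, (Fin.succ_ne_zero k).symm]
  · simp [crCoeff, crConjCoeff]
  · simp only [crCoeff, crConjCoeff, Fin.cons_succ, _root_.neg_apply, map_neg,
      genAction_apply, smul_smul, Fin.succ_inj]
    rw [← neg_add, ← add_smul, gen_mul_add_swap, algebraMap_smul]
    split_ifs <;> simp

end Clifford

/-! ### Translation between functions on `Ω` and their extensions by zero. -/

section ZeroExtension

variable {n : ℕ} {Ω : Opens (Space n)}
variable {V : Type*} [NormedAddCommGroup V] [NormedSpace ℝ V]

lemma zeroExt_apply (f : Ω → V) (x : Ω) : zeroExt f x = f x :=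
  Subtype.val_injective.extend_apply f 0 x

lemma zeroExt_pderiv (j : Fin (n + 1)) (f : Ω → V) :
    Set.EqOn (zeroExt (pderiv j f)) (pd j (zeroExt f)) Ω := fun x hx =>
  zeroExt_apply (pderiv j f) ⟨x, hx⟩

/-- The list depends on `β` alone, so one list serves the whole sequence and its limit. -/
lemma exists_pdList_eqOn_multiDeriv (β : Fin (n + 1) → ℕ) : ∃ l : List (Fin (n + 1)),
    ∀ f : Ω → V, Set.EqOn (zeroExt (multiDeriv β f)) (pdList l (zeroExt f)) Ω := by
  have hiter : ∀ (j : Fin (n + 1)) (m : ℕ) (f : Ω → V), Set.EqOn (zeroExt ((pderiv j)^[m] f))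
      (pdList (List.replicate m j) (zeroExt f)) Ω := by
    intro j m f
    induction m with
    | zero => exact fun _ _ => rfl
    | succ m ih =>
      rw [Function.iterate_succ_apply', List.replicate_succ, pdList_cons]
      exact (zeroExt_pderiv j _).trans (pd_eqOn Ω.isOpen ih j)
  have hlist : ∀ L : List (Fin (n + 1)), ∃ l : List (Fin (n + 1)), ∀ f : Ω → V,
      Set.EqOn (zeroExt (L.foldr (fun j g => (pderiv j)^[β j] g) f)) (pdList l (zeroExt f)) Ω := by
    intro L
    induction L with
    | nil => exact ⟨[], fun f _ _ => rfl⟩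
    | cons j L ih =>
      obtain ⟨l, hl⟩ := ih
      refine ⟨List.replicate (β j) j ++ l, fun f => ?_⟩
      rw [pdList_append]
      exact (hiter j (β j) _).trans (pdList_eqOn Ω.isOpen (hl f) _)
  exact hlist _

lemma tendstoUniformlyOn_zeroExt {F : ℕ → Ω → V} {f : Ω → V}
    (h : ∀ K : Set Ω, IsCompact K → TendstoUniformlyOn F f atTop K) {K : Set (Space n)}
    (hKΩ : K ⊆ Ω) (hK : IsCompact K) :
    TendstoUniformlyOn (fun j => zeroExt (F j)) (zeroExt f) atTop K := by
  have hK' : IsCompact ((↑) ⁻¹' K : Set Ω) := by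
    have himage : ((↑) : Ω → Space n) '' ((↑) ⁻¹' K) = K :=
      Set.image_preimage_eq_of_subset fun x hx => ⟨⟨x, hKΩ hx⟩, rfl⟩
    rwa [Subtype.isCompact_iff, himage]
  intro s hs
  filter_upwards [h _ hK' s hs] with j hj x hx
  have := hj ⟨x, hKΩ hx⟩ hx
  rwa [← zeroExt_apply f ⟨x, hKΩ hx⟩, ← zeroExt_apply (F j) ⟨x, hKΩ hx⟩] at this

variable [FiniteDimensional ℝ V] [Module (Cl n) V] [IsScalarTower ℝ (Cl n) V]

lemma diracOp_zeroExt (f : Ω → V) (x : Ω) :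
    diracOp (crCoeff V) (zeroExt f) x = cauchyRiemann f x := by
  simp only [diracOp, Fin.sum_univ_succ, crCoeff, Fin.cons_zero, Fin.cons_succ,
    _root_.neg_apply, genAction_apply, Finset.sum_neg_distrib, ← sub_eq_add_neg]
  rfl

lemma mem_MSolutions_iff {M : C(Ω, V) →L[ℝ] C(Ω, V)} {u : C(Ω, V)} :
    (u : Ω → V) ∈ MSolutions M ↔
      IsOfClass 1 (u : Ω → V) ∧ cauchyRiemann (u : Ω → V) = M u := by
  constructor
  · rintro ⟨v, hv, h1, h2⟩
    obtain rfl : v = u := DFunLike.coe_injective hv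
    exact ⟨h1, funext fun x => sub_eq_iff_eq_add'.2 (h2 x)⟩
  · rintro ⟨h1, h2⟩
    exact ⟨u, rfl, h1, fun x => sub_eq_iff_eq_add'.1 (congrFun h2 x)⟩

/-- The source of the chains: the commutation hypothesis turns `D (M^k u) = M^(k+1) u` into the same
relation for `k + 1`, and also gives the `C^1` regularity of each iterate. -/
lemma iterate_of_mem_MSolutions {M : C(Ω, V) →L[ℝ] C(Ω, V)}
    (hM : CommutesWithCauchyRiemann M) {u : C(Ω, V)} (hu : (u : Ω → V) ∈ MSolutions M) (k : ℕ) :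
    IsOfClass 1 (M^[k] u : Ω → V) ∧ cauchyRiemann (M^[k] u : Ω → V) = M^[k + 1] u := by
  induction k with
  | zero => exact mem_MSolutions_iff.1 hu
  | succ k ih =>
    have := hM _ _ ih.1 ih.2
    rwa [← Function.iterate_succ_apply' M k, ← Function.iterate_succ_apply' M (k + 1)] at this

end ZeroExtension

end CliffordWeierstrass

/-! ### Weierstrass' theorem. -/

theorem mainTheorem6 (n : ℕ)
    {V : Type*} [NormedAddCommGroup V] [NormedSpace ℝ V] [FiniteDimensional ℝ V]
    [Module (CliffordWeierstrass.Cl n) V] [IsScalarTower ℝ (CliffordWeierstrass.Cl n) V]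
    (Ω : Opens (CliffordWeierstrass.Space n))
    (M : C(Ω, V) →L[ℝ] C(Ω, V))
    (hM : CliffordWeierstrass.CommutesWithCauchyRiemann M)
    (F : ℕ → Ω → V) (f : Ω → V)
    (hF : ∀ k, F k ∈ CliffordWeierstrass.MSolutions M)
    (hlim : ∀ K : Set Ω, IsCompact K → TendstoUniformlyOn F f atTop K) :
    f ∈ CliffordWeierstrass.MSolutions M ∧
      (∀ k, CliffordWeierstrass.IsOfClass ⊤ (F k)) ∧
      CliffordWeierstrass.IsOfClass ⊤ f ∧
      ∀ β : Fin (n + 1) → ℕ, ∀ K : Set Ω, IsCompact K →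
        TendstoUniformlyOn (fun k => CliffordWeierstrass.multiDeriv β (F k))
          (CliffordWeierstrass.multiDeriv β f) atTop K := by
  open CliffordWeierstrass in
  have : LocallyCompactSpace Ω := Ω.isOpen.locallyCompactSpace
  have hcont : ∀ j, ∃ u : C(Ω, V), (u : Ω → V) = F j := fun j => (hF j).imp fun u hu => hu.1
  choose u hu using hcont
  obtain rfl : (fun j => (u j : Ω → V)) = F := funext hu
  have hfc : Continuous f :=
    (tendstoLocallyUniformly_iff_forall_isCompact.2 hlim).continuous
      (Frequently.of_forall fun j => (u j).continuous)
  obtain ⟨g, rfl⟩ : ∃ g : C(Ω, V), (g : Ω → V) = f := ⟨⟨f, hfc⟩, rfl⟩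
  -- Uniform convergence on compact sets is convergence in the topology of `C(Ω, V)`, so the
  -- continuous iterates of `M` preserve it.
  have hug : Tendsto u atTop (𝓝 g) :=
    ContinuousMap.tendsto_iff_forall_isCompact_tendstoUniformlyOn.2 hlim
  have hiter : ∀ k, ∀ K ⊆ (Ω : Set (Space n)), IsCompact K →
      TendstoUniformlyOn (fun j => zeroExt (M^[k] (u j) : Ω → V)) (zeroExt (M^[k] g : Ω → V))
        atTop K := fun k K hKΩ hK =>
    tendstoUniformlyOn_zeroExt (ContinuousMap.tendsto_iff_forall_isCompact_tendstoUniformlyOn.1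
      (((M.continuous.iterate k).tendsto g).comp hug)) hKΩ hK
  have hclass : ∀ j k, ContDiffOn ℝ 1 (zeroExt (M^[k] (u j) : Ω → V)) Ω := fun j k =>
    (iterate_of_mem_MSolutions hM (hF j) k).1
  have hD : ∀ j k, Set.EqOn (diracOp (crCoeff V) (zeroExt (M^[k] (u j) : Ω → V)))
      (zeroExt (M^[k + 1] (u j) : Ω → V)) Ω := fun j k x hx => by
    rw [diracOp_zeroExt _ ⟨x, hx⟩, (iterate_of_mem_MSolutions hM (hF j) k).2]
    exact (zeroExt_apply _ ⟨x, hx⟩).symm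
  obtain ⟨hsmooth, hDg, hunif⟩ := tendstoUniformlyOn_pdList_of_diracOp crConjCoeff_crCoeff
    Ω.isOpen hclass hD hiter
  refine ⟨mem_MSolutions_iff.2 ⟨hsmooth.of_le (by simp), funext fun x => ?_⟩, fun j => ?_, hsmooth,
    fun β K hK => ?_⟩
  · rw [← diracOp_zeroExt, ← zeroExt_apply (M g : Ω → V)]
    exact hDg x.2
  · exact contDiffOn_infty_of_diracOp crConjCoeff_crCoeff Ω.isOpen (hclass j) (hD j)
  · obtain ⟨l, hl⟩ := exists_pdList_eqOn_multiDeriv (Ω := Ω) (V := V) β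
    intro s hs
    filter_upwards [hunif l ((↑) '' K) (by rintro _ ⟨x, -, rfl⟩; exact x.2)
      (hK.image continuous_subtype_val) s hs] with j hj x hx
    have := hj x ⟨x, hx, rfl⟩
    rwa [← zeroExt_apply (multiDeriv β (g : Ω → V)), ← zeroExt_apply (multiDeriv β (u j : Ω → V)),
      hl _ x.2, hl _ x.2]
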